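/- Let $\mathcal H_1,\mathcal H_2$ be complex Hilbert spaces and let $A$ in $\mathcal H_1$, $B$ from $\mathcal H_2$ to $\mathcal H_1$, $C$ from $\mathcal H_1$ to $\mathcal H_2$, $D$ in $\mathcal H_2$ be densely defined closable linear operators with $C\subseteq B^*$. Assume that the operator matrix $$\mathcal A=\begin{pmatrix}A&B\\ C&D\end{pmatrix},\qquad \operatorname{dom}\mathcal A=(\operatorname{dom}A\cap\operatorname{dom}C)\oplus(\operatorname{dom}B\cap\operatorname{dom}D),$$ is densely defined in $\mathcal H_1\oplus\mathcal H_2$. For a linear operator $T$ let $W(T)=\{(Tf,f): f\in\operatorname{dom}T,\ \|f\|=1\}$ be its numerical range, and for $\omega\in[0,\pi/2]$ let $\Sigma_\omega=\{z\in\mathbb C:|\arg z|\le\omega\}$, where $\arg z\in(-\pi,\pi]$ and $\arg 0=0$. Suppose that there are real numbers $\delta<0<\alpha$ and $\varphi,\psi\in[0,\pi/2]$ with $$\operatorname{Re}W(D)\le\delta<0<\alpha\le\operatorname{Re}W(A),\qquad W(A)\subseteq\Sigma_\varphi,\qquad W(D)\subseteq-\Sigma_\psi .$$ Put $\tau=\max\{\varphi,\psi\}$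 and $$\Sigma=(-\Sigma_\tau\cup\Sigma_\tau)\cap\{z\in\mathbb C:\operatorname{Re}z\notin(\delta,\alpha)\},\qquad \theta_0=\begin{cases}\max\{\frac\pi2+\frac{\varphi-\psi}2,\ \tau\},&\varphi\le\psi,\\ \min\{\frac\pi2+\frac{\varphi-\psi}2,\ \pi-\tau\},&\psi<\varphi,\end{cases}$$ and $M_{\theta_0}=\sin(\theta_0-\varphi)\sin(\theta_0+\psi)$. Here $T$ is called m-accretive if it is densely defined, $\operatorname{Re}W(T)\ge0$ and $\{\operatorname{Re}z<0\}\subseteq\rho(T)$; it is called m-sectorial with vertex $0$ and semi-angle $\omega<\pi/2$ if it is m-accretive and $W(T)\subseteq\Sigma_\omega$. An operator $S$ is $T$-bounded if $\operatorname{dom}T\subseteq\operatorname{dom}S$ and there are $a,b\ge0$ with $\|Sx\|\le a\|x\|+b\|Tx\|$ for all $x\in\operatorname{dom}T$; its relative bound is the infimum of all such $b$. If $\varphi,\psi<\pi/2$, then $M_{\theta_0}\in(0,1]$. Moreover, suppose that one of the following holds: (i′) $A$ and $-D$ are m-sectorial with vertex $0$ and semi-angles $\varphi,\psi<\pi/2$,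 respectively, $C$ is $A$-bounded with relative bound $\delta_A$, $B$ is $D$-bounded with relative bound $\delta_D$, and $\delta_A\delta_D<M_{\theta_0}$; (ii′) $A$ and $-D$ are m-accretive, $C=B^*$, $A$ is $C$-bounded with relative bound $\delta_C$, $D$ is $B$-bounded with relative bound $\delta_B$, $\delta_B\delta_C<1$, $B$ and $C$ are boundedly invertible, and there are constants $a_C,b_C,a_B,b_B\ge0$ with $$\|Ax\|^2\le a_C^2\|x\|^2+b_C^2\|Cx\|^2\ (x\in\operatorname{dom}C),\qquad \|Dy\|^2\le a_B^2\|y\|^2+b_B^2\|By\|^2\ (y\in\operatorname{dom}B),$$ $$\sqrt{a_C^2\|B^{-1}\|^2+b_C^2}\ \sqrt{a_B^2\|B^{-1}\|^2+b_B^2}<1 .$$ Then $\rho(\mathcal A)\cap(\mathbb C\setminus\Sigma)\ne\emptyset$, and hence $\sigma(\mathcal A)\subseteq\Sigma$. -/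

import Mathlib

open Set
open scoped Pointwise

noncomputable section

namespace OpMatrix

section General

variable {E F G : Type*}
  [NormedAddCommGroup E] [InnerProductSpace ℂ E]
  [NormedAddCommGroup F] [InnerProductSpace ℂ F]
  [NormedAddCommGroup G] [InnerProductSpace ℂ G]

/-- The numerical range `W(T)`, i.e. all values `(T f, f)` with `f ∈ dom T`, `‖f‖ = 1`.
Mathlib's inner product is linear in its second argument. -/
def numRange (T : E →ₗ.[ℂ] E) : Set ℂ :=
  {z | ∃ f : T.domain, ‖(f : E)‖ = 1 ∧ inner ℂ (f : E) (T f) = z}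

/-- The operator `T - z` on `dom T`. -/
def shift (T : E →ₗ.[ℂ] E) (z : ℂ) : E →ₗ.[ℂ] E where
  domain := T.domain
  toFun := T.toFun - z • T.domain.subtype

/-- `R` is an everywhere defined bounded two-sided inverse of the unbounded operator `T`. -/
def IsBoundedInverse (T : E →ₗ.[ℂ] F) (R : F →L[ℂ] E) : Prop :=
  (∀ y : F, ∃ h : R y ∈ T.domain, T ⟨R y, h⟩ = y) ∧ ∀ x : T.domain, R (T x) = x

/-- `T` is boundedly invertible. -/
def BoundedlyInvertible (T : E →ₗ.[ℂ] F) : Prop :=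
  ∃ R : F →L[ℂ] E, IsBoundedInverse T R

/-- The resolvent set `ρ(T)`. -/
def resolventSet (T : E →ₗ.[ℂ] E) : Set ℂ :=
  {z | BoundedlyInvertible (shift T z)}

/-- The spectrum `σ(T)`. -/
def spec (T : E →ₗ.[ℂ] E) : Set ℂ := (resolventSet T)ᶜ

/-- m-accretivity: `T` is densely defined, accretive, and the open left half-plane belongs to the
resolvent set (the usual bound `‖(T - z)⁻¹‖ ≤ 1 / |Re z|` there follows from accretivity). -/
def IsMAccretive (T : E →ₗ.[ℂ] E) : Prop :=
  Dense (T.domain : Set E) ∧ (∀ z ∈ numRange T, 0 ≤ z.re) ∧ ∀ z : ℂ, z.re < 0 → z ∈ resolventSet T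

/-- `‖S x‖ ≤ a ‖x‖ + b ‖T x‖` for all `x ∈ dom T ⊆ dom S`. -/
def RelBoundWith (S : E →ₗ.[ℂ] F) (T : E →ₗ.[ℂ] G) (a b : ℝ) : Prop :=
  ∃ h : T.domain ≤ S.domain, ∀ x : T.domain, ‖S ⟨x, h x.2⟩‖ ≤ a * ‖(x : E)‖ + b * ‖T x‖

/-- `‖S x‖² ≤ a² ‖x‖² + b² ‖T x‖²` for all `x ∈ dom T ⊆ dom S`. -/
def SqRelBoundWith (S : E →ₗ.[ℂ] F) (T : E →ₗ.[ℂ] G) (a b : ℝ) : Prop :=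
  ∃ h : T.domain ≤ S.domain, ∀ x : T.domain,
    ‖S ⟨x, h x.2⟩‖ ^ 2 ≤ a ^ 2 * ‖(x : E)‖ ^ 2 + b ^ 2 * ‖T x‖ ^ 2

/-- `S` is `T`-bounded. -/
def IsRelBounded (S : E →ₗ.[ℂ] F) (T : E →ₗ.[ℂ] G) : Prop :=
  ∃ a b : ℝ, 0 ≤ a ∧ 0 ≤ b ∧ RelBoundWith S T a b

/-- The `T`-bound (relative bound) of a `T`-bounded operator `S`: the infimum of all `b ≥ 0` that
are admissible in `‖S x‖ ≤ a ‖x‖ + b ‖T x‖` for some `a ≥ 0`. -/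
def relBound (S : E →ₗ.[ℂ] F) (T : E →ₗ.[ℂ] G) : ℝ :=
  sInf {b : ℝ | 0 ≤ b ∧ ∃ a : ℝ, 0 ≤ a ∧ RelBoundWith S T a b}

end General

/-- The closed sector `Σ_ω` with vertex `0`, semi-axis `ℝ₊` and semi-angle `ω`
(`Complex.arg 0 = 0`, so `0` belongs to it when `0 ≤ ω`). -/
def sector (ω : ℝ) : Set ℂ := {z | |z.arg| ≤ ω}

/-- m-sectoriality with vertex `0` and semi-angle `ω < π / 2`. -/
def IsMSectorial {E : Type*} [NormedAddCommGroup E] [InnerProductSpace ℂ E]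
    (T : E →ₗ.[ℂ] E) (ω : ℝ) : Prop :=
  ω < Real.pi / 2 ∧ numRange T ⊆ sector ω ∧ IsMAccretive T

/-- The set `(-Σ_τ ∪ Σ_τ) ∩ {z | Re z ∉ (δ, α)}` with `τ = max {φ, ψ}`. -/
def enclosure (α δ φ ψ : ℝ) : Set ℂ :=
  (-sector (max φ ψ) ∪ sector (max φ ψ)) ∩ {z | z.re ∉ Ioo δ α}

/-- The angle `θ₀`. -/
def theta0 (φ ψ : ℝ) : ℝ :=
  if φ ≤ ψ then max (Real.pi / 2 + (φ - ψ) / 2) (max φ ψ)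
  else min (Real.pi / 2 + (φ - ψ) / 2) (Real.pi - max φ ψ)

/-- The constant `M_{θ₀} = sin (θ₀ - φ) sin (θ₀ + ψ)`. -/
def Mconst (φ ψ : ℝ) : ℝ :=
  Real.sin (theta0 φ ψ - φ) * Real.sin (theta0 φ ψ + ψ)

section Block

variable {H₁ H₂ : Type*}
  [NormedAddCommGroup H₁] [InnerProductSpace ℂ H₁]
  [NormedAddCommGroup H₂] [InnerProductSpace ℂ H₂]

/-- The domain `(dom A ∩ dom C) ⊕ (dom B ∩ dom D)` of the operator matrix. -/
def blockDomain (A : H₁ →ₗ.[ℂ] H₁) (B : H₂ →ₗ.[ℂ] H₁) (C : H₁ →ₗ.[ℂ] H₂) (D : H₂ →ₗ.[ℂ] H₂) :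
    Submodule ℂ (WithLp 2 (H₁ × H₂)) :=
  (A.domain ⊓ C.domain).comap (WithLp.fstₗ 2 ℂ H₁ H₂) ⊓
    (B.domain ⊓ D.domain).comap (WithLp.sndₗ 2 ℂ H₁ H₂)

/-- The operator matrix `(A B; C D)` in the Hilbert space `H₁ ⊕ H₂`, acting by
`(x, y) ↦ (A x + B y, C x + D y)`. -/
def blockOp (A : H₁ →ₗ.[ℂ] H₁) (B : H₂ →ₗ.[ℂ] H₁) (C : H₁ →ₗ.[ℂ] H₂) (D : H₂ →ₗ.[ℂ] H₂) :
    WithLp 2 (H₁ × H₂) →ₗ.[ℂ] WithLp 2 (H₁ × H₂) where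
  domain := blockDomain A B C D
  toFun :=
    { toFun := fun x => WithLp.toLp 2
        (A ⟨x.1.fst, x.2.1.1⟩ + B ⟨x.1.snd, x.2.2.1⟩, C ⟨x.1.fst, x.2.1.2⟩ + D ⟨x.1.snd, x.2.2.2⟩)
      map_add' := fun x y => by
        have hA := A.map_add ⟨x.1.fst, x.2.1.1⟩ ⟨y.1.fst, y.2.1.1⟩
        have hB := B.map_add ⟨x.1.snd, x.2.2.1⟩ ⟨y.1.snd, y.2.2.1⟩
        have hC := C.map_add ⟨x.1.fst, x.2.1.2⟩ ⟨y.1.fst, y.2.1.2⟩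
        have hD := D.map_add ⟨x.1.snd, x.2.2.2⟩ ⟨y.1.snd, y.2.2.2⟩
        rw [← WithLp.toLp_add, Prod.mk_add_mk, add_add_add_comm, ← hA, ← hB,
          add_add_add_comm (C _), ← hC, ← hD]
        rfl
      map_smul' := fun c x => by
        have hA := A.map_smul c ⟨x.1.fst, x.2.1.1⟩
        have hB := B.map_smul c ⟨x.1.snd, x.2.2.1⟩
        have hC := C.map_smul c ⟨x.1.fst, x.2.1.2⟩
        have hD := D.map_smul c ⟨x.1.snd, x.2.2.2⟩
        rw [RingHom.id_apply, ← WithLp.toLp_smul, Prod.smul_mk, smul_add, smul_add, ← hA, ← hB,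
          ← hC, ← hD]
        rfl }

/-- The diagonally dominant hypothesis: the diagonal entries are m-sectorial with vertex `0`,
`C` is `A`-bounded, `B` is `D`-bounded and the product of the two relative bounds is less than
`M_{θ₀}`. -/
def DiagDominant (A : H₁ →ₗ.[ℂ] H₁) (B : H₂ →ₗ.[ℂ] H₁) (C : H₁ →ₗ.[ℂ] H₂) (D : H₂ →ₗ.[ℂ] H₂)
    (φ ψ : ℝ) : Prop :=
  IsMSectorial A φ ∧ IsMSectorial (-D) ψ ∧ IsRelBounded C A ∧ IsRelBounded B D ∧
    relBound C A * relBound B D < Mconst φ ψ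

/-- The off-diagonally dominant hypothesis. -/
def OffDiagDominant [CompleteSpace H₂] (A : H₁ →ₗ.[ℂ] H₁) (B : H₂ →ₗ.[ℂ] H₁)
    (C : H₁ →ₗ.[ℂ] H₂) (D : H₂ →ₗ.[ℂ] H₂) : Prop :=
  IsMAccretive A ∧ IsMAccretive (-D) ∧ C = B.adjoint ∧ IsRelBounded A C ∧ IsRelBounded D B ∧
    relBound D B * relBound A C < 1 ∧ BoundedlyInvertible C ∧
    ∃ Binv : H₁ →L[ℂ] H₂, IsBoundedInverse B Binv ∧
      ∃ aC bC aB bB : ℝ, 0 ≤ aC ∧ 0 ≤ bC ∧ 0 ≤ aB ∧ 0 ≤ bB ∧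
        SqRelBoundWith A C aC bC ∧ SqRelBoundWith D B aB bB ∧
        Real.sqrt (aC ^ 2 * ‖Binv‖ ^ 2 + bC ^ 2) * Real.sqrt (aB ^ 2 * ‖Binv‖ ^ 2 + bB ^ 2) < 1

end Block

end OpMatrix

end

namespace OpMatrix

open scoped ComplexConjugate

/-! ### Resolvent sets, Neumann series and continuation along connected sets. -/

section Resolvent

variable {E F G : Type*}
  [NormedAddCommGroup E] [InnerProductSpace ℂ E]
  [NormedAddCommGroup F] [InnerProductSpace ℂ F]
  [NormedAddCommGroup G] [InnerProductSpace ℂ G]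

/-! Write `(𝒜 - z)(x, y) = (f, g)` and pair it as `(f, x) - conj (g, y)`. Since `C ⊆ B*`, the
off-diagonal terms cancel, leaving only `(Ax, x)` and the conjugate of `(Dy, y)`. For `z` outside
`Σ`, a rotation `e` separates these two contributions, and `𝒜 - z` is bounded below
(`blockOp_lowerBound`, `exists_blockOp_lowerBound`).

The complement of `Σ` is star-shaped about `0`, hence connected. On it `ρ(𝒜)` is open, and
relatively closed by the lower bounds, so a single resolvent point outside `Σ` suffices
(`subset_resolventSet`, `isPreconnected_compl_enclosure`).

Such a point comes from a Neumann series. In the diagonally dominant case, `𝒜 - z` is `(I Q; P I)`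
times `diag(A - z, D - z)`, where `P = C(A - z)⁻¹` and `Q = B(D - z)⁻¹`. For `z = r e^{iθ}` the
numerical ranges give `‖P‖ ≤ (a/r + b)/sin(θ - φ)` and `‖Q‖ ≤ (a'/r + b')/sin(θ + ψ)`; with `θ` near
`θ₀` and `r` large the product is below `1`. In the off-diagonally dominant case `z = 0` works, with
`AC⁻¹` and `DB⁻¹` in place of `P` and `Q`. -/

theorem shift_apply (T : E →ₗ.[ℂ] E) (z : ℂ) (x : T.domain) :
    shift T z x = T x - z • (x : E) := rfl

theorem isBoundedInverse_of_rightInverse {T : E →ₗ.[ℂ] F} {R : F →L[ℂ] E}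
    (hR : ∀ y : F, ∃ h : R y ∈ T.domain, T ⟨R y, h⟩ = y)
    {c : ℝ} (hc : 0 < c) (hT : ∀ x : T.domain, c * ‖(x : E)‖ ≤ ‖T x‖) :
    IsBoundedInverse T R := by
  refine ⟨hR, fun x => ?_⟩
  obtain ⟨h, hx⟩ := hR (T x)
  have h1 := hT (⟨R (T x), h⟩ - x)
  rw [LinearPMap.map_sub, hx, sub_self, norm_zero] at h1
  have h2 : ‖R (T x) - (x : E)‖ ≤ 0 := by
    by_contra h3
    push Not at h3
    have := mul_pos hc h3
    exact absurd h1 (not_le.mpr this)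
  exact sub_eq_zero.mp (norm_le_zero_iff.mp h2)

theorem lowerBound_shift {T : E →ₗ.[ℂ] E} {c : ℝ} {z : ℂ}
    (h : ∀ x : T.domain, c * ‖(x : E)‖ ≤ ‖T x - z • (x : E)‖) (w : ℂ) (x : T.domain) :
    (c - ‖w - z‖) * ‖(x : E)‖ ≤ ‖T x - w • (x : E)‖ := by
  have h1 : T x - z • (x : E) = (T x - w • (x : E)) + (w - z) • (x : E) := by
    rw [sub_smul]; abel
  have h2 := h x
  rw [h1] at h2
  have h3 := norm_add_le (T x - w • (x : E)) ((w - z) • (x : E))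
  rw [norm_smul] at h3
  linarith

/-- The lower bound gives `‖(T - z)⁻¹‖ ≤ 1/c`, and `(T - w)(T - z)⁻¹ = 1 - (w - z)(T - z)⁻¹` is
inverted by a Neumann series. The radius depends only on `c`, which is what makes the resolvent set
relatively closed where lower bounds hold. -/
theorem mem_resolventSet_of_near [CompleteSpace E] {T : E →ₗ.[ℂ] E} {c : ℝ} {z w : ℂ}
    (h : ∀ x : T.domain, c * ‖(x : E)‖ ≤ ‖T x - z • (x : E)‖)
    (hz : z ∈ resolventSet T) (hw : ‖w - z‖ < c) : w ∈ resolventSet T := by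
  obtain ⟨R, hR, -⟩ := hz
  have hc : 0 < c := (norm_nonneg _).trans_lt hw
  have hRn : ‖R‖ ≤ 1 / c := by
    refine R.opNorm_le_bound (by positivity) fun y => ?_
    obtain ⟨hy, hy'⟩ := hR y
    have := h ⟨R y, hy⟩
    change T ⟨R y, hy⟩ - z • R y = y at hy'
    rw [hy'] at this
    rw [div_mul_eq_mul_div, one_mul, le_div_iff₀ hc, mul_comm]
    exact this
  have hK : ‖(w - z) • R‖ < 1 := by
    rw [norm_smul]
    calc ‖w - z‖ * ‖R‖ ≤ ‖w - z‖ * (1 / c) := by gcongr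
      _ < 1 := by rw [mul_one_div, div_lt_one hc]; exact hw
  obtain ⟨S, hS⟩ := (isUnit_one_sub_of_norm_lt_one hK).exists_right_inv
  refine ⟨R ∘L S, isBoundedInverse_of_rightInverse (fun y => ?_) (sub_pos.mpr hw)
    (fun x => lowerBound_shift h w x)⟩
  obtain ⟨hy, hy'⟩ := hR (S y)
  refine ⟨hy, ?_⟩
  have h1 : S y - (w - z) • R (S y) = y := by
    simpa using congrArg (fun L : E →L[ℂ] E => L y) hS
  change T ⟨R (S y), hy⟩ - z • R (S y) = S y at hy'
  change T ⟨R (S y), hy⟩ - w • R (S y) = y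
  rw [sub_smul] at h1
  rw [← sub_eq_zero] at hy' h1 ⊢
  calc _ = _ := ?_
    _ = (0 : E) + 0 := congrArg₂ (· + ·) hy' h1
    _ = 0 := add_zero 0
  abel

theorem isOpen_resolventSet [CompleteSpace E] (T : E →ₗ.[ℂ] E) : IsOpen (resolventSet T) := by
  rw [Metric.isOpen_iff]
  intro z hz
  obtain ⟨R, hR⟩ := id hz
  have hp : 0 < ‖R‖ + 1 := by positivity
  refine ⟨1 / (‖R‖ + 1), by positivity, fun w hw => ?_⟩
  refine mem_resolventSet_of_near (fun x => ?_) hz (mem_ball_iff_norm.mp hw)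
  have h1 := R.le_opNorm (shift T z x)
  rw [hR.2 x, shift_apply] at h1
  rw [div_mul_eq_mul_div, one_mul, div_le_iff₀ hp]
  have := norm_nonneg (T x - z • (x : E))
  nlinarith

/-- If `T - z` is bounded below at every point of a preconnected set that meets the resolvent
set, then the whole set consists of points of the resolvent set. -/
theorem subset_resolventSet [CompleteSpace E] {T : E →ₗ.[ℂ] E} {s : Set ℂ}
    (hs : IsPreconnected s) (hne : (s ∩ resolventSet T).Nonempty)
    (h : ∀ z ∈ s, ∃ c : ℝ, 0 < c ∧ ∀ x : T.domain, c * ‖(x : E)‖ ≤ ‖T x - z • (x : E)‖) :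
    s ⊆ resolventSet T := by
  refine hs.subset_of_closure_inter_subset (isOpen_resolventSet T) hne ?_
  rintro z ⟨hz, hzs⟩
  obtain ⟨c, hc, hb⟩ := h z hzs
  -- At distance less than `c / 2`, the constant `c - ‖w - z‖` inherited by `w` still exceeds the
  -- distance back to `z`.
  obtain ⟨w, hw, hwz⟩ := Metric.mem_closure_iff.mp hz (c / 2) (by positivity)
  rw [dist_eq_norm] at hwz
  refine mem_resolventSet_of_near (lowerBound_shift hb w) hw ?_
  rw [norm_sub_rev w z]
  linarith

/-- The bound on `S` is evaluated at `x = R y`, where `T x = y`; this makes `S R` everywhere defined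
and bounded by `k`. -/
theorem exists_comp_boundedInverse {T : E →ₗ.[ℂ] F} {R : F →L[ℂ] E} (hR : IsBoundedInverse T R)
    (S : E →ₗ.[ℂ] G) {k : ℝ} (hk : 0 ≤ k) (hd : T.domain ≤ S.domain)
    (hS : ∀ x : T.domain, ‖S ⟨x, hd x.2⟩‖ ≤ k * ‖T x‖) :
    ∃ P : F →L[ℂ] G, ‖P‖ ≤ k ∧ ∀ y, ∃ h : R y ∈ S.domain, S ⟨R y, h⟩ = P y := by
  have hmem : ∀ y, R y ∈ S.domain := fun y => hd (hR.1 y).1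
  let L : F →ₗ[ℂ] G := S.toFun ∘ₗ (R : F →ₗ[ℂ] E).codRestrict S.domain hmem
  have hL : ∀ y, ‖L y‖ ≤ k * ‖y‖ := by
    intro y
    obtain ⟨h, hy⟩ := hR.1 y
    have := hS ⟨R y, h⟩
    rw [hy] at this
    exact this
  exact ⟨L.mkContinuous k hL, L.mkContinuous_norm_le hk hL, fun y => ⟨hmem y, rfl⟩⟩

/-- Eliminating the second unknown leaves `(1 - QP) u = p₁ - Q p₂`, solvable because `‖QP‖ < 1`. -/
theorem exists_solve_offDiag [CompleteSpace E] (P : E →L[ℂ] F) (Q : F →L[ℂ] E)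
    (h : ‖P‖ * ‖Q‖ < 1) :
    ∃ (U : E × F →L[ℂ] E) (V : E × F →L[ℂ] F),
      ∀ p, U p + Q (V p) = p.1 ∧ P (U p) + V p = p.2 := by
  have hK : ‖Q ∘L P‖ < 1 :=
    (Q.opNorm_comp_le P).trans_lt (by rwa [mul_comm])
  obtain ⟨S, hS⟩ := (isUnit_one_sub_of_norm_lt_one hK).exists_right_inv
  have h1 : ∀ x, S x - Q (P (S x)) = x := fun x => by
    simpa using congrArg (fun L : E →L[ℂ] E => L x) hS
  let U : E × F →L[ℂ] E :=
    S ∘L (ContinuousLinearMap.fst ℂ E F - Q ∘L ContinuousLinearMap.snd ℂ E F)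
  refine ⟨U, ContinuousLinearMap.snd ℂ E F - P ∘L U, fun p => ⟨?_, ?_⟩⟩
  · have := h1 (p.1 - Q p.2)
    simp only [U, sub_apply, ContinuousLinearMap.comp_apply,
      ContinuousLinearMap.coe_fst', ContinuousLinearMap.coe_snd', map_sub] at this ⊢
    rw [← sub_eq_zero] at this ⊢
    rw [← this]
    abel
  · simp

end Resolvent

/-! ### Resolvent estimates from a half-plane containing the numerical range. -/

section NumericalRange

variable {E : Type*} [NormedAddCommGroup E] [InnerProductSpace ℂ E]

theorem mul_le_of_mul_sq_le {a b c : ℝ} (hb : 0 ≤ b) (hc : 0 ≤ c) (h : a * b ^ 2 ≤ b * c) :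
    a * b ≤ c := by
  rcases hb.eq_or_lt with rfl | hb
  · simpa using hc
  · nlinarith

theorem inner_self_eq_ofReal (v : E) : inner ℂ v v = ((‖v‖ ^ 2 : ℝ) : ℂ) := by
  rw [inner_self_eq_norm_sq_to_K]; norm_cast

theorem le_re_mul_inner_of_numRange {T : E →ₗ.[ℂ] E} {e : ℂ} {k : ℝ}
    (h : ∀ z ∈ numRange T, k ≤ (e * z).re) (x : T.domain) :
    k * ‖(x : E)‖ ^ 2 ≤ (e * inner ℂ (x : E) (T x)).re := by
  by_cases hx : (x : E) = 0
  · simp [hx]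
  have hn : 0 < ‖(x : E)‖ := norm_pos_iff.mpr hx
  set t : ℝ := ‖(x : E)‖ with ht
  have ht0 : (t : ℂ) ≠ 0 := by exact_mod_cast hn.ne'
  have h1 := h _ ⟨((t : ℂ)⁻¹) • x, by
    rw [Submodule.coe_smul, norm_smul, norm_inv, Complex.norm_real, Real.norm_eq_abs,
      abs_of_pos hn, ← ht, inv_mul_cancel₀ hn.ne'], rfl⟩
  rw [LinearPMap.map_smul, Submodule.coe_smul, inner_smul_left, inner_smul_right, map_inv₀,
    Complex.conj_ofReal] at h1
  have h2 : e * inner ℂ (x : E) (T x)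
      = ((t ^ 2 : ℝ) : ℂ) * (e * ((t : ℂ)⁻¹ * ((t : ℂ)⁻¹ * inner ℂ (x : E) (T x)))) := by
    push_cast
    field_simp
  rw [h2, Complex.re_ofReal_mul, mul_comm]
  gcongr

theorem im_mul_inner_nonpos_of_numRange {T : E →ₗ.[ℂ] E} {e : ℂ}
    (h : ∀ z ∈ numRange T, (e * z).im ≤ 0) (x : T.domain) :
    (e * inner ℂ (x : E) (T x)).im ≤ 0 := by
  have key : ∀ w : ℂ, (Complex.I * e * w).re = -(e * w).im := fun w => by
    rw [mul_assoc, Complex.I_mul_re]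
  have := le_re_mul_inner_of_numRange (T := T) (e := Complex.I * e) (k := 0)
    (fun z hz => by rw [key]; linarith [h z hz]) x
  rw [key] at this
  linarith

/-- With `y = Tx - rwx`, pairing `y` with `x` gives the first bound and pairing it with `Tx` the
second. In both, the contribution of `e (Tx, x)` has a favourable sign. The second controls `T(T -
rw)⁻¹` uniformly in `r`, so only the relative bound survives as `r → ∞`. -/
theorem norm_resolvent_bounds {T : E →ₗ.[ℂ] E} {e w : ℂ} {r : ℝ} (he : ‖e‖ = 1) (hw : ‖w‖ = 1)
    (hr : 0 ≤ r) (h : ∀ x : T.domain, (e * inner ℂ (x : E) (T x)).im ≤ 0) (x : T.domain) :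
    (e * w).im * r * ‖(x : E)‖ ≤ ‖T x - (r * w : ℂ) • (x : E)‖ ∧
      (e * w).im * ‖T x‖ ≤ ‖T x - (r * w : ℂ) • (x : E)‖ := by
  set y := T x - (r * w : ℂ) • (x : E) with hy
  constructor
  · refine mul_le_of_mul_sq_le (norm_nonneg _) (norm_nonneg _) ?_
    have h1 : inner ℂ (x : E) y = inner ℂ (x : E) (T x) - r * w * ((‖(x : E)‖ ^ 2 : ℝ) : ℂ) := by
      rw [hy, inner_sub_right, inner_smul_right, inner_self_eq_ofReal]
    have h2 : -(e * inner ℂ (x : E) y).im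
        = -(e * inner ℂ (x : E) (T x)).im + (e * w).im * r * ‖(x : E)‖ ^ 2 := by
      rw [h1]
      have : e * (inner ℂ (x : E) (T x) - r * w * ((‖(x : E)‖ ^ 2 : ℝ) : ℂ))
        = e * inner ℂ (x : E) (T x) - ((r * ‖(x : E)‖ ^ 2 : ℝ) : ℂ) * (e * w) := by
        push_cast; ring
      rw [this, Complex.sub_im, Complex.im_ofReal_mul]
      ring
    have h3 : -(e * inner ℂ (x : E) y).im ≤ ‖(x : E)‖ * ‖y‖ := by
      refine (neg_le_abs _).trans ((Complex.abs_im_le_norm _).trans ?_)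
      rw [norm_mul, he, one_mul]
      exact norm_inner_le_norm _ _
    have := h x
    linarith
  · refine mul_le_of_mul_sq_le (norm_nonneg _) (norm_nonneg _) ?_
    have h1 : inner ℂ (T x) y
        = ((‖T x‖ ^ 2 : ℝ) : ℂ) - r * w * conj (inner ℂ (x : E) (T x)) := by
      rw [hy, inner_sub_right, inner_smul_right, inner_self_eq_ofReal, inner_conj_symm]
    -- The factor `e w` is chosen so that `|w| = 1` turns the cross term into `r e (Tx, x)`.
    have h2 : (e * w * conj (inner ℂ (T x) y)).im
        = (e * w).im * ‖T x‖ ^ 2 - r * (e * inner ℂ (x : E) (T x)).im := by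
      have hww : w * conj w = 1 := by rw [Complex.mul_conj, Complex.normSq_eq_norm_sq, hw]; simp
      have : e * w * conj (inner ℂ (T x) y)
          = ((‖T x‖ ^ 2 : ℝ) : ℂ) * (e * w) - (r : ℂ) * (e * inner ℂ (x : E) (T x)) := by
        rw [h1, map_sub, map_mul, map_mul, Complex.conj_ofReal, Complex.conj_ofReal,
          Complex.conj_conj]
        linear_combination (-(r : ℂ) * e * inner ℂ (x : E) (T x)) * hww
      rw [this, Complex.sub_im, Complex.im_ofReal_mul, Complex.im_ofReal_mul]
      ring
    have h3 : (e * w * conj (inner ℂ (T x) y)).im ≤ ‖T x‖ * ‖y‖ := by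
      refine (le_abs_self _).trans ((Complex.abs_im_le_norm _).trans ?_)
      rw [norm_mul, norm_mul, he, hw, one_mul, one_mul, RCLike.norm_conj]
      exact norm_inner_le_norm _ _
    have := mul_nonpos_of_nonneg_of_nonpos hr (h x)
    linarith

theorem mem_resolventSet_of_halfPlane [CompleteSpace E] {T : E →ₗ.[ℂ] E} {e : ℂ} (he : ‖e‖ = 1)
    (h : ∀ x : T.domain, (e * inner ℂ (x : E) (T x)).im ≤ 0) {z₀ : ℂ} (hz₀ : 0 < (e * z₀).im)
    (hρ : z₀ ∈ resolventSet T) {z : ℂ} (hz : 0 < (e * z).im) : z ∈ resolventSet T := by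
  have hconv : Convex ℝ {z : ℂ | 0 < (e * z).im} := by
    intro z hz w hw a b ha hb hab
    have : (e * (a • z + b • w)).im = a * (e * z).im + b * (e * w).im := by
      simp [Complex.mul_im]; ring
    simp only [mem_ofPred_eq] at hz hw ⊢
    rw [this]
    rcases ha.eq_or_lt with rfl | ha
    · have : b = 1 := by linarith
      subst this; simpa using hw
    · have := mul_pos ha hz
      have := mul_nonneg hb hw.le
      linarith
  refine subset_resolventSet hconv.isPreconnected ⟨z₀, hz₀, hρ⟩ (fun v hv => ?_) hz
  refine ⟨(e * v).im, hv, fun x => ?_⟩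
  have hv0 : v ≠ 0 := by rintro rfl; simp at hv
  have hn : (‖v‖ : ℂ) ≠ 0 := by simpa using hv0
  have h1 := (norm_resolvent_bounds (w := v / ‖v‖) (r := ‖v‖) he
    (by simp [hv0]) (norm_nonneg v) h x).1
  have h2 : (‖v‖ : ℂ) * (v / ‖v‖) = v := by field_simp
  have h3 : (e * (v / ‖v‖)).im * ‖v‖ = (e * v).im := by
    rw [mul_comm, ← Complex.im_ofReal_mul]
    congr 1
    field_simp
  rwa [h2, h3] at h1

end NumericalRange

/-! ### Geometry of the sectors, the enclosure and the angle `θ₀`. -/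

section Sector

open Real

/-- The two linear inequalities say that `sin (ω ∓ arg z) ≥ 0`; the condition on `Re z` excludes the
opposite sector. -/
theorem mem_sector_iff {ω : ℝ} (h0 : 0 ≤ ω) (h1 : ω ≤ π / 2) {z : ℂ} :
    z ∈ sector ω ↔ 0 ≤ z.re ∧ |z.im| * cos ω ≤ z.re * sin ω := by
  have hre : z.re = ‖z‖ * cos z.arg := (Complex.norm_mul_cos_arg z).symm
  have him : z.im = ‖z‖ * sin z.arg := (Complex.norm_mul_sin_arg z).symm
  have hcos : 0 ≤ cos ω := cos_nonneg_of_mem_Icc ⟨by linarith, h1⟩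
  have e1 : z.re * sin ω - z.im * cos ω = ‖z‖ * sin (ω - z.arg) := by
    rw [hre, him, sin_sub]; ring
  have e2 : z.re * sin ω + z.im * cos ω = ‖z‖ * sin (ω + z.arg) := by
    rw [hre, him, sin_add]; ring
  have habs : |z.im| * cos ω = |z.im * cos ω| := by rw [abs_mul, abs_of_nonneg hcos]
  rw [habs, abs_le, sector, mem_ofPred_eq, ← Complex.abs_arg_le_pi_div_two_iff, abs_le, abs_le]
  constructor
  · rintro ⟨ha, hb⟩
    have s1 : 0 ≤ sin (ω - z.arg) := sin_nonneg_of_nonneg_of_le_pi (by linarith) (by linarith)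
    have s2 : 0 ≤ sin (ω + z.arg) := sin_nonneg_of_nonneg_of_le_pi (by linarith) (by linarith)
    have := mul_nonneg (norm_nonneg z) s1
    have := mul_nonneg (norm_nonneg z) s2
    exact ⟨⟨by linarith, by linarith⟩, by linarith, by linarith⟩
  · rintro ⟨⟨ha, hb⟩, hc, hd⟩
    by_cases hz : z = 0
    · subst hz; simp [h0]
    have hn : 0 < ‖z‖ := norm_pos_iff.mpr hz
    constructor
    · by_contra! hlt
      have := mul_neg_of_pos_of_neg hn
        (sin_neg_of_neg_of_neg_pi_lt (x := ω + z.arg) (by linarith) (by linarith [pi_pos]))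
      linarith
    · by_contra! hlt
      have := mul_neg_of_pos_of_neg hn
        (sin_neg_of_neg_of_neg_pi_lt (x := ω - z.arg) (by linarith) (by linarith [pi_pos]))
      linarith

theorem sector_mono {ω ω' : ℝ} (h : ω ≤ ω') : sector ω ⊆ sector ω' :=
  fun _ hz => le_trans hz h

theorem notMem_neg_sector_union_iff {τ : ℝ} (h0 : 0 ≤ τ) (h1 : τ ≤ π / 2) {z : ℂ} :
    z ∉ -sector τ ∪ sector τ ↔ |z.re| * sin τ < |z.im| * cos τ := by
  rw [← not_le, not_iff_not, mem_union, mem_neg, mem_sector_iff h0 h1, mem_sector_iff h0 h1,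
    Complex.neg_re, Complex.neg_im, abs_neg]
  have hsin : 0 ≤ sin τ := sin_nonneg_of_nonneg_of_le_pi h0 (by linarith [pi_pos])
  constructor
  · rintro (⟨ha, hb⟩ | ⟨ha, hb⟩)
    · rwa [abs_of_nonpos (neg_nonneg.mp ha)]
    · rwa [abs_of_nonneg ha]
  · intro h
    rcases le_total z.re 0 with ha | ha
    · rw [abs_of_nonpos ha] at h
      exact Or.inl ⟨by linarith, h⟩
    · rw [abs_of_nonneg ha] at h
      exact Or.inr ⟨ha, h⟩

theorem notMem_enclosure_iff {α δ φ ψ : ℝ} (h0 : 0 ≤ max φ ψ) (h1 : max φ ψ ≤ π / 2) {z : ℂ} :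
    z ∉ enclosure α δ φ ψ ↔
      |z.re| * sin (max φ ψ) < |z.im| * cos (max φ ψ) ∨ z.re ∈ Ioo δ α := by
  rw [← notMem_neg_sector_union_iff h0 h1, enclosure, mem_inter_iff, mem_ofPred_eq, not_and_or,
    not_not]

/-- The complement of the double sector is invariant under positive scaling, and the strip `δ < Re z
< α` is star-shaped about `0`. The strip joins the upper and lower pieces. -/
theorem isPreconnected_compl_enclosure {α δ φ ψ : ℝ} (hδ : δ < 0) (hα : 0 < α)
    (h0 : 0 ≤ max φ ψ) (h1 : max φ ψ ≤ π / 2) : IsPreconnected (enclosure α δ φ ψ)ᶜ := by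
  have hstar : StarConvex ℝ (0 : ℂ) (enclosure α δ φ ψ)ᶜ := by
    rw [starConvex_zero_iff]
    intro z hz t ht ht1
    rw [mem_compl_iff, notMem_enclosure_iff h0 h1] at hz ⊢
    rw [Complex.smul_re, Complex.smul_im, smul_eq_mul, smul_eq_mul]
    rcases ht.eq_or_lt with rfl | htp
    · simp [hδ, hα]
    rcases hz with hz | ⟨ha, hb⟩
    · left
      rw [abs_mul, abs_mul, abs_of_pos htp, mul_assoc, mul_assoc]
      gcongr
    · exact Or.inr ⟨by nlinarith, by nlinarith⟩
  have h0mem : (0 : ℂ) ∈ (enclosure α δ φ ψ)ᶜ := by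
    rw [mem_compl_iff, notMem_enclosure_iff h0 h1]
    simp [hδ, hα]
  exact (hstar.isPathConnected h0mem).isConnected.isPreconnected

/-- Positivity holds because `φ < θ₀ < π - ψ`, so both sines have arguments in `(0, π)`. -/
theorem Mconst_mem_Ioc {φ ψ : ℝ} (hφ : 0 ≤ φ) (hψ : 0 ≤ ψ) (hφ' : φ < π / 2) (hψ' : ψ < π / 2) :
    Mconst φ ψ ∈ Ioc 0 1 := by
  have hlo : φ < theta0 φ ψ := by
    unfold theta0
    split_ifs with h
    · exact lt_max_of_lt_left (by linarith)
    · rw [max_eq_left (by linarith)]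
      exact lt_min (by linarith) (by linarith)
  have hup : theta0 φ ψ < π - ψ := by
    unfold theta0
    split_ifs with h
    · rw [max_eq_right h]
      exact max_lt (by linarith) (by linarith)
    · exact min_lt_of_left_lt (by linarith)
  have s1 : 0 < sin (theta0 φ ψ - φ) := sin_pos_of_pos_of_lt_pi (by linarith) (by linarith)
  have s2 : 0 < sin (theta0 φ ψ + ψ) := sin_pos_of_pos_of_lt_pi (by linarith) (by linarith)
  exact ⟨mul_pos s1 s2, mul_le_one₀ (sin_le_one _) s2.le (sin_le_one _)⟩

/-- The product `sin (θ - φ) sin (θ + ψ)` equals `(cos (φ + ψ) - cos (2θ + ψ - φ)) / 2` and peaks at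
`π/2 + (φ - ψ)/2`; `θ₀` is this angle truncated to `[τ, π - τ]`. -/
theorem theta0_mem_Icc {φ ψ : ℝ} (hφ' : φ < π / 2) (hψ' : ψ < π / 2) :
    theta0 φ ψ ∈ Icc (max φ ψ) (π - max φ ψ) := by
  unfold theta0
  split_ifs with h
  · rw [max_eq_right h]
    exact ⟨le_max_right _ _, max_le (by linarith) (by linarith)⟩
  · rw [max_eq_left (by linarith)]
    exact ⟨le_min (by linarith) (by linarith), min_le_right _ _⟩

/-- An angle strictly between `τ` and `π - τ` at which the product of the sines is as close to
`M_{θ₀}` as desired. -/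
theorem exists_angle {φ ψ m : ℝ} (hφ' : φ < π / 2) (hψ' : ψ < π / 2) (hm : m < Mconst φ ψ) :
    ∃ θ ∈ Ioo (max φ ψ) (π - max φ ψ), m < sin (θ - φ) * sin (θ + ψ) := by
  have hτ : max φ ψ < π / 2 := max_lt hφ' hψ'
  -- `θ₀` may be an endpoint, where the ray lies on the boundary of the double sector, so it is
  -- approximated from inside.
  have hmem : theta0 φ ψ ∈ closure (Ioo (max φ ψ) (π - max φ ψ)) := by
    rw [closure_Ioo (by linarith)]
    exact theta0_mem_Icc hφ' hψ'
  have hcont : Continuous fun θ : ℝ => sin (θ - φ) * sin (θ + ψ) := by fun_prop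
  obtain ⟨θ, h1, h2⟩ := mem_closure_iff_nhds.mp hmem _
    (hcont.continuousAt.eventually_mem (Ioi_mem_nhds hm))
  exact ⟨θ, h2, h1⟩

theorem exp_mul_im (t : ℝ) (z : ℂ) :
    (Complex.exp (t * Complex.I) * z).im = z.im * cos t + z.re * sin t := by
  rw [Complex.mul_im, Complex.exp_ofReal_mul_I_re, Complex.exp_ofReal_mul_I_im]
  ring

end Sector

/-! ### Lower bounds and resolvent points for the operator matrix. -/

section Block

variable {H₁ H₂ : Type*}
  [NormedAddCommGroup H₁] [InnerProductSpace ℂ H₁]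
  [NormedAddCommGroup H₂] [InnerProductSpace ℂ H₂]

/-- A right inverse of `𝒜 - z` from componentwise solvability. -/
theorem mem_resolventSet_blockOp {A : H₁ →ₗ.[ℂ] H₁} {B : H₂ →ₗ.[ℂ] H₁} {C : H₁ →ₗ.[ℂ] H₂}
    {D : H₂ →ₗ.[ℂ] H₂} {z : ℂ} {c : ℝ} (hc : 0 < c)
    (hlow : ∀ u : (blockOp A B C D).domain,
      c * ‖(u : WithLp 2 (H₁ × H₂))‖ ≤ ‖blockOp A B C D u - z • (u : WithLp 2 (H₁ × H₂))‖)
    (X : H₁ × H₂ →L[ℂ] H₁) (Y : H₁ × H₂ →L[ℂ] H₂)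
    (hXY : ∀ p, ∃ (hA : X p ∈ A.domain) (hB : Y p ∈ B.domain) (hC : X p ∈ C.domain)
      (hD : Y p ∈ D.domain), A ⟨X p, hA⟩ + B ⟨Y p, hB⟩ - z • X p = p.1 ∧
        C ⟨X p, hC⟩ + D ⟨Y p, hD⟩ - z • Y p = p.2) :
    z ∈ resolventSet (blockOp A B C D) := by
  let e := WithLp.prodContinuousLinearEquiv 2 ℂ H₁ H₂
  refine ⟨(e.symm : H₁ × H₂ →L[ℂ] WithLp 2 (H₁ × H₂)) ∘L (X.prod Y) ∘L
    (e : WithLp 2 (H₁ × H₂) →L[ℂ] H₁ × H₂),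
    isBoundedInverse_of_rightInverse (fun p => ?_) hc hlow⟩
  obtain ⟨hA, hB, hC, hD, h1, h2⟩ := hXY (e p)
  refine ⟨⟨⟨hA, hC⟩, ⟨hB, hD⟩⟩, ?_⟩
  refine (WithLp.ofLp_injective 2) ?_
  exact Prod.ext h1 h2

/-- Conjugating the second pairing makes the `B` and `C` terms cancel. The real part of `e` times
the difference is then at least `k (‖x‖² + ‖y‖²)`, and Cauchy–Schwarz bounds it above by `‖u‖ ‖v‖`.
-/
theorem blockOp_lowerBound [CompleteSpace H₂] {A : H₁ →ₗ.[ℂ] H₁}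
    {B : H₂ →ₗ.[ℂ] H₁} {C : H₁ →ₗ.[ℂ] H₂} {D : H₂ →ₗ.[ℂ] H₂} (hB : Dense (B.domain : Set H₂))
    (hCB : C ≤ B.adjoint) {e z : ℂ} {k : ℝ} (he : ‖e‖ = 1)
    (hA : ∀ w ∈ numRange A, k + (e * z).re ≤ (e * w).re)
    (hD : ∀ w ∈ numRange D, k + (e * conj w).re ≤ (e * conj z).re)
    (u : (blockOp A B C D).domain) :
    k * ‖(u : WithLp 2 (H₁ × H₂))‖ ≤ ‖blockOp A B C D u - z • (u : WithLp 2 (H₁ × H₂))‖ := by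
  have hconj : ∀ w : ℂ, (conj e * w).re = (e * conj w).re := fun w => by
    simp [Complex.mul_re]
  set v := blockOp A B C D u - z • (u : WithLp 2 (H₁ × H₂)) with hv
  obtain ⟨w, ⟨hwA, hwC⟩, ⟨hwB, hwD⟩⟩ := u
  change w.fst ∈ A.domain at hwA
  change w.fst ∈ C.domain at hwC
  change w.snd ∈ B.domain at hwB
  change w.snd ∈ D.domain at hwD
  have hf : v.fst = A ⟨w.fst, hwA⟩ + B ⟨w.snd, hwB⟩ - z • w.fst := rfl
  have hg : v.snd = C ⟨w.fst, hwC⟩ + D ⟨w.snd, hwD⟩ - z • w.snd := rfl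
  have hBC : conj (inner ℂ w.snd (C ⟨w.fst, hwC⟩)) = inner ℂ w.fst (B ⟨w.snd, hwB⟩) := by
    rw [inner_conj_symm, hCB.2 (x := ⟨w.fst, hwC⟩) (y := ⟨w.fst, hCB.1 hwC⟩) rfl]
    exact LinearPMap.adjoint_isFormalAdjoint hB ⟨w.fst, hCB.1 hwC⟩ ⟨w.snd, hwB⟩
  have h1 : e * (inner ℂ w.fst v.fst - conj (inner ℂ w.snd v.snd)) =
      (e * inner ℂ w.fst (A ⟨w.fst, hwA⟩) - ((‖w.fst‖ ^ 2 : ℝ) : ℂ) * (e * z)) +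
      (((‖w.snd‖ ^ 2 : ℝ) : ℂ) * (e * conj z) - e * conj (inner ℂ w.snd (D ⟨w.snd, hwD⟩))) := by
    rw [hf, hg, inner_sub_right, inner_add_right, inner_sub_right, inner_add_right,
      inner_smul_right, inner_smul_right, inner_self_eq_ofReal, inner_self_eq_ofReal, map_sub,
      map_add, map_mul, hBC, Complex.conj_ofReal]
    ring
  have h2 := congrArg Complex.re h1
  rw [Complex.add_re, Complex.sub_re, Complex.sub_re, Complex.re_ofReal_mul,
    Complex.re_ofReal_mul] at h2
  have h3 : (e * (inner ℂ w.fst v.fst - conj (inner ℂ w.snd v.snd))).re ≤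
      ‖w.fst‖ * ‖v.fst‖ + ‖w.snd‖ * ‖v.snd‖ := by
    refine (Complex.re_le_norm _).trans ?_
    rw [norm_mul, he, one_mul]
    refine (norm_sub_le _ _).trans ?_
    rw [RCLike.norm_conj]
    exact add_le_add (norm_inner_le_norm _ _) (norm_inner_le_norm _ _)
  have h4 := le_re_mul_inner_of_numRange hA ⟨w.fst, hwA⟩
  -- The conjugate on `(Dy, y)` is moved onto `e`; the minus sign turns the upper bound on `W(D)`
  -- into a lower bound.
  have h5 := le_re_mul_inner_of_numRange (T := D) (e := -conj e) (k := k - (e * conj z).re)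
    (fun w hw => by rw [neg_mul, Complex.neg_re, hconj]; linarith [hD w hw]) ⟨w.snd, hwD⟩
  rw [neg_mul, Complex.neg_re, hconj] at h5
  have hw2 := WithLp.prod_norm_sq_eq_of_L2 w
  have hv2 := WithLp.prod_norm_sq_eq_of_L2 v
  have h6 : ‖w.fst‖ * ‖v.fst‖ + ‖w.snd‖ * ‖v.snd‖ ≤ ‖w‖ * ‖v‖ := by
    refine abs_le_of_sq_le_sq' ?_ (by positivity) |>.2
    rw [mul_pow, hw2, hv2]
    nlinarith [sq_nonneg (‖w.fst‖ * ‖v.snd‖ - ‖w.snd‖ * ‖v.fst‖)]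
  refine mul_le_of_mul_sq_le (norm_nonneg w) (norm_nonneg v) ?_
  rw [hw2]
  dsimp only at h4 h5
  linarith

theorem exists_blockOp_lowerBound [CompleteSpace H₂] {A : H₁ →ₗ.[ℂ] H₁}
    {B : H₂ →ₗ.[ℂ] H₁} {C : H₁ →ₗ.[ℂ] H₂} {D : H₂ →ₗ.[ℂ] H₂} (hB : Dense (B.domain : Set H₂))
    (hCB : C ≤ B.adjoint) {α δ φ ψ : ℝ}
    (hφ : φ ∈ Icc 0 (Real.pi / 2)) (hψ : ψ ∈ Icc 0 (Real.pi / 2))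
    (hWDδ : ∀ z ∈ numRange D, z.re ≤ δ) (hWAα : ∀ z ∈ numRange A, α ≤ z.re)
    (hWA : numRange A ⊆ sector φ) (hWD : numRange D ⊆ -sector ψ) {z : ℂ}
    (hz : z ∉ enclosure α δ φ ψ) :
    ∃ c : ℝ, 0 < c ∧ ∀ u : (blockOp A B C D).domain,
      c * ‖(u : WithLp 2 (H₁ × H₂))‖ ≤ ‖blockOp A B C D u - z • (u : WithLp 2 (H₁ × H₂))‖ := by
  have h0 : 0 ≤ max φ ψ := hφ.1.trans (le_max_left _ _)
  have h1 : max φ ψ ≤ Real.pi / 2 := max_le hφ.2 hψ.2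
  rcases (notMem_enclosure_iff h0 h1).mp hz with hz | ⟨hz1, hz2⟩
  · set τ := max φ ψ with hτ
    have hsin : 0 ≤ Real.sin τ :=
      Real.sin_nonneg_of_nonneg_of_le_pi h0 (by linarith [Real.pi_pos])
    have hcos : 0 ≤ Real.cos τ := Real.cos_nonneg_of_mem_Icc ⟨by linarith, h1⟩
    -- `s` is the sign of `Im z`; the rotation `sin τ + i s cos τ` sends `Σ_τ` into the right
    -- half-plane and `z` into the left one.
    obtain ⟨s, hs2, hs⟩ : ∃ s : ℝ, s ^ 2 = 1 ∧ s * z.im = |z.im| := by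
      rcases le_total 0 z.im with h | h
      · exact ⟨1, by norm_num, by rw [abs_of_nonneg h, one_mul]⟩
      · exact ⟨-1, by norm_num, by rw [abs_of_nonpos h, neg_one_mul]⟩
    have hsle : ∀ t : ℝ, |s * t| = |t| := fun t => by
      rw [abs_mul, show |s| = 1 from by rw [← sq_eq_sq₀ (abs_nonneg s) zero_le_one, sq_abs, hs2, one_pow], one_mul]
    have hre : ∀ w : ℂ, ((⟨Real.sin τ, s * Real.cos τ⟩ : ℂ) * w).re =
        Real.sin τ * w.re - s * w.im * Real.cos τ := fun w => by
      rw [Complex.mul_re]; ring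
    have hbound : ∀ w ∈ sector τ, ∀ t : ℝ, |t| = |w.im| →
        t * Real.cos τ ≤ w.re * Real.sin τ := fun w hw t ht =>
      (mul_le_mul_of_nonneg_right (le_abs_self t) hcos).trans
        (ht ▸ ((mem_sector_iff h0 h1).mp hw).2)
    have hzre := mul_le_mul_of_nonneg_right (le_abs_self z.re) hsin
    have hzre' := mul_le_mul_of_nonneg_right (neg_abs_le z.re) hsin
    refine ⟨|z.im| * Real.cos τ - |z.re| * Real.sin τ, sub_pos.mpr hz,
      blockOp_lowerBound hB hCB (e := ⟨Real.sin τ, s * Real.cos τ⟩) ?_ (fun w hw => ?_)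
        fun w hw => ?_⟩
    · rw [← sq_eq_sq₀ (norm_nonneg _) zero_le_one, ← Complex.normSq_eq_norm_sq,
        Complex.normSq_mk]
      linear_combination Real.sin_sq_add_cos_sq τ + Real.cos τ ^ 2 * hs2
    · have := hbound w (sector_mono (le_max_left _ _) (hWA hw)) (s * w.im) (hsle _)
      rw [hre, hre, hs]
      linarith
    · have := hbound (-w) (sector_mono (le_max_right _ _) (hWD hw)) (s * w.im)
        (by rw [hsle, Complex.neg_im, abs_neg])
      rw [hre, hre, Complex.conj_re, Complex.conj_im, Complex.conj_re, Complex.conj_im,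
        mul_neg, mul_neg, hs]
      rw [Complex.neg_re] at this
      linarith
  · refine ⟨min (α - z.re) (z.re - δ), lt_min (by linarith) (by linarith),
      blockOp_lowerBound hB hCB (e := 1) norm_one (fun w hw => ?_) fun w hw => ?_⟩
    · rw [one_mul, one_mul]
      linarith [hWAα w hw, min_le_left (α - z.re) (z.re - δ)]
    · rw [one_mul, one_mul, Complex.conj_re, Complex.conj_re]
      linarith [hWDδ w hw, min_le_right (α - z.re) (z.re - δ)]

/-- Substituting `x = C⁻¹ v` and `y = B⁻¹ u` turns `𝒜(x, y) = p` into a perturbed identity with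
off-diagonal entries `AC⁻¹` and `DB⁻¹`. The square-root constants bound their norms. -/
theorem zero_mem_resolventSet_of_offDiagDominant [CompleteSpace H₁] [CompleteSpace H₂]
    {A : H₁ →ₗ.[ℂ] H₁} {B : H₂ →ₗ.[ℂ] H₁} {C : H₁ →ₗ.[ℂ] H₂} {D : H₂ →ₗ.[ℂ] H₂}
    (hB : Dense (B.domain : Set H₂)) {c : ℝ} (hc : 0 < c)
    (hlow : ∀ u : (blockOp A B C D).domain, c * ‖(u : WithLp 2 (H₁ × H₂))‖ ≤
      ‖blockOp A B C D u - (0 : ℂ) • (u : WithLp 2 (H₁ × H₂))‖)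
    (h : OffDiagDominant A B C D) : 0 ∈ resolventSet (blockOp A B C D) := by
  obtain ⟨-, -, hCB, -, -, -, ⟨Cinv, hCinv⟩, Binv, hBinv, aC, bC, aB, bB, -, -, -, -, ⟨hdA, hA⟩,
    ⟨hdD, hD⟩, hlt⟩ := h
  -- Since `C = B*`, `‖C⁻¹v‖² = (v, B⁻¹C⁻¹v)`, so `‖C⁻¹‖ ≤ ‖B⁻¹‖`; this is why only `‖B⁻¹‖` enters
  -- the hypothesis.
  have hCn : ∀ v, ‖Cinv v‖ ≤ ‖Binv‖ * ‖v‖ := by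
    intro v
    obtain ⟨h1, h1'⟩ := hCinv.1 v
    obtain ⟨h2, h2'⟩ := hBinv.1 (Cinv v)
    subst hCB
    have h3 := LinearPMap.adjoint_isFormalAdjoint hB ⟨Cinv v, h1⟩ ⟨Binv (Cinv v), h2⟩
    rw [h1', h2', inner_self_eq_ofReal] at h3
    have h4 : ‖Cinv v‖ ^ 2 ≤ ‖v‖ * (‖Binv‖ * ‖Cinv v‖) := by
      have := norm_inner_le_norm (𝕜 := ℂ) v (Binv (Cinv v))
      rw [h3, Complex.norm_real, Real.norm_of_nonneg (by positivity)] at this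
      exact this.trans (by gcongr; exact Binv.le_opNorm _)
    have := mul_le_of_mul_sq_le (a := 1) (norm_nonneg (Cinv v))
      (mul_nonneg (norm_nonneg Binv) (norm_nonneg v)) (by linarith)
    linarith
  have sq_bound : ∀ a b n x t y : ℝ, 0 ≤ x → 0 ≤ t → 0 ≤ y → x ≤ n * t →
      y ^ 2 ≤ a ^ 2 * x ^ 2 + b ^ 2 * t ^ 2 → y ≤ Real.sqrt (a ^ 2 * n ^ 2 + b ^ 2) * t := by
    intro a b n x t y hx ht hy hxt h
    refine abs_le_of_sq_le_sq' ?_ (by positivity) |>.2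
    rw [mul_pow, Real.sq_sqrt (by positivity)]
    have : x ^ 2 ≤ n ^ 2 * t ^ 2 := by rw [← mul_pow]; gcongr
    nlinarith [mul_le_mul_of_nonneg_left this (sq_nonneg a)]
  obtain ⟨P, hPn, hP⟩ := exists_comp_boundedInverse hCinv A (Real.sqrt_nonneg _) hdA fun x =>
    sq_bound aC bC ‖Binv‖ ‖(x : H₁)‖ ‖C x‖ _ (norm_nonneg _) (norm_nonneg _) (norm_nonneg _)
      (by simpa only [hCinv.2 x] using hCn (C x)) (hA x)
  obtain ⟨Q, hQn, hQ⟩ := exists_comp_boundedInverse hBinv D (Real.sqrt_nonneg _) hdD fun y =>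
    sq_bound aB bB ‖Binv‖ ‖(y : H₂)‖ ‖B y‖ _ (norm_nonneg _) (norm_nonneg _) (norm_nonneg _)
      (by simpa only [hBinv.2 y] using Binv.le_opNorm (B y)) (hD y)
  obtain ⟨U, V, hUV⟩ := exists_solve_offDiag Q P (by
    rw [mul_comm]
    exact (mul_le_mul hPn hQn (norm_nonneg _) (Real.sqrt_nonneg _)).trans_lt hlt)
  refine mem_resolventSet_blockOp hc hlow (Cinv ∘L V) (Binv ∘L U) fun p => ?_
  obtain ⟨hC1, hC2⟩ := hCinv.1 (V p)
  obtain ⟨hB1, hB2⟩ := hBinv.1 (U p)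
  obtain ⟨hA1, hA2⟩ := hP (V p)
  obtain ⟨hD1, hD2⟩ := hQ (U p)
  refine ⟨hA1, hB1, hC1, hD1, ?_, ?_⟩
  · simp only [ContinuousLinearMap.comp_apply, hA2, hB2, zero_smul, sub_zero]
    rw [add_comm]
    exact (hUV p).1
  · simp only [ContinuousLinearMap.comp_apply, hC2, hD2, zero_smul, sub_zero]
    rw [add_comm]
    exact (hUV p).2

/-! ### Diagonal dominance: relative bounds and resolvents on a ray. -/

theorem exists_relBoundWith_lt {E F G : Type*} [NormedAddCommGroup E] [InnerProductSpace ℂ E]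
    [NormedAddCommGroup F] [InnerProductSpace ℂ F] [NormedAddCommGroup G] [InnerProductSpace ℂ G]
    {S : E →ₗ.[ℂ] F} {T : E →ₗ.[ℂ] G} (h : IsRelBounded S T) {ε : ℝ} (hε : 0 < ε) :
    ∃ a b : ℝ, 0 ≤ a ∧ 0 ≤ b ∧ b < relBound S T + ε ∧ RelBoundWith S T a b := by
  obtain ⟨a₀, b₀, ha₀, hb₀, h₀⟩ := h
  obtain ⟨b, ⟨hb, a, ha, hS⟩, hlt⟩ := exists_lt_of_csInf_lt
    (s := {b : ℝ | 0 ≤ b ∧ ∃ a : ℝ, 0 ≤ a ∧ RelBoundWith S T a b})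
    ⟨b₀, hb₀, a₀, ha₀, h₀⟩ (lt_add_of_pos_right (relBound S T) hε)
  exact ⟨a, b, ha, hb, hlt, hS⟩

/-- A relative bound is an infimum that need not be attained; the strict inequality leaves room to
raise both factors by a small `ε`. -/
theorem exists_relBoundWith_mul_lt {S : H₁ →ₗ.[ℂ] H₂} {T : H₁ →ₗ.[ℂ] H₁} {S' : H₂ →ₗ.[ℂ] H₁}
    {T' : H₂ →ₗ.[ℂ] H₂} (h : IsRelBounded S T) (h' : IsRelBounded S' T') {m : ℝ}
    (hm : relBound S T * relBound S' T' < m) :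
    ∃ a b a' b' : ℝ, 0 ≤ a ∧ 0 ≤ b ∧ 0 ≤ a' ∧ 0 ≤ b' ∧ b * b' < m ∧
      RelBoundWith S T a b ∧ RelBoundWith S' T' a' b' := by
  have hcont : Continuous fun ε : ℝ => (relBound S T + ε) * (relBound S' T' + ε) := by fun_prop
  have h0 : ∀ᶠ ε in nhds (0 : ℝ), (relBound S T + ε) * (relBound S' T' + ε) < m :=
    hcont.continuousAt.eventually_lt continuousAt_const (by simpa using hm)
  obtain ⟨ε, hεm, hε⟩ := ((h0.filter_mono nhdsWithin_le_nhds).and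
    (self_mem_nhdsWithin (s := Ioi (0 : ℝ)))).exists
  obtain ⟨a, b, ha, hb, hlt, hS⟩ := exists_relBoundWith_lt h hε
  obtain ⟨a', b', ha', hb', hlt', hS'⟩ := exists_relBoundWith_lt h' hε
  exact ⟨a, b, a', b', ha, hb, ha', hb',
    (mul_le_mul hlt.le hlt'.le hb' (hb.trans hlt.le)).trans_lt hεm, hS, hS'⟩

/-- If `e W(T)` lies in the closed lower half-plane and `Im (e w) > 0`, then the resolvent at `r w`
exists and a `T`-bounded operator composed with it has norm close to `b / Im (e w)`, `r` large. -/
theorem exists_relBounded_comp_resolvent [CompleteSpace H₁] {T : H₁ →ₗ.[ℂ] H₁}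
    {S : H₁ →ₗ.[ℂ] H₂} {a b r : ℝ} (ha : 0 ≤ a) (hb : 0 ≤ b) (hr : 0 < r) {e w z₀ : ℂ}
    (he : ‖e‖ = 1) (hw : ‖w‖ = 1) (hW : ∀ z ∈ numRange T, (e * z).im ≤ 0)
    (hz₀ : 0 < (e * z₀).im) (hρ : z₀ ∈ resolventSet T) (hew : 0 < (e * w).im)
    (hS : RelBoundWith S T a b) :
    ∃ R : H₁ →L[ℂ] H₁, IsBoundedInverse (shift T (r * w)) R ∧
      ∃ P : H₁ →L[ℂ] H₂, ‖P‖ ≤ (a / r + b) / (e * w).im ∧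
        ∀ y, ∃ h : R y ∈ S.domain, S ⟨R y, h⟩ = P y := by
  have hT := im_mul_inner_nonpos_of_numRange hW
  obtain ⟨R, hR⟩ := mem_resolventSet_of_halfPlane he hT hz₀ hρ (z := r * w) (by
    rw [mul_left_comm, Complex.im_ofReal_mul]
    positivity)
  obtain ⟨hd, hS⟩ := hS
  refine ⟨R, hR, exists_comp_boundedInverse hR S (by positivity) hd fun x => ?_⟩
  obtain ⟨h1, h2⟩ := norm_resolvent_bounds he hw hr.le hT x
  change _ ≤ _ * ‖T x - (r * w : ℂ) • (x : H₁)‖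
  set s := (e * w).im
  set n := ‖T x - (r * w : ℂ) • (x : H₁)‖
  have h3 : ‖(x : H₁)‖ ≤ n / (s * r) := (le_div_iff₀' (by positivity)).mpr h1
  have h4 : ‖T x‖ ≤ n / s := (le_div_iff₀' hew).mpr h2
  calc ‖S ⟨x, hd x.2⟩‖ ≤ a * ‖(x : H₁)‖ + b * ‖T x‖ := hS x
    _ ≤ a * (n / (s * r)) + b * (n / s) := by gcongr
    _ = (a / r + b) / s * n := by field_simp

theorem exists_mem_resolventSet_of_diagDominant [CompleteSpace H₁] [CompleteSpace H₂]
    {A : H₁ →ₗ.[ℂ] H₁} {B : H₂ →ₗ.[ℂ] H₁} {C : H₁ →ₗ.[ℂ] H₂} {D : H₂ →ₗ.[ℂ] H₂}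
    {α δ φ ψ : ℝ} (hφ : 0 ≤ φ) (hψ : 0 ≤ ψ)
    (hWA : numRange A ⊆ sector φ) (hWD : numRange D ⊆ -sector ψ)
    (hlow : ∀ z ∉ enclosure α δ φ ψ, ∃ c : ℝ, 0 < c ∧ ∀ u : (blockOp A B C D).domain,
      c * ‖(u : WithLp 2 (H₁ × H₂))‖ ≤ ‖blockOp A B C D u - z • (u : WithLp 2 (H₁ × H₂))‖)
    (h : DiagDominant A B C D φ ψ) :
    ∃ z ∈ resolventSet (blockOp A B C D), z ∉ enclosure α δ φ ψ := by
  obtain ⟨⟨hφ', -, -, -, hρA⟩, ⟨hψ', -, -, -, hρD⟩, hCA, hBD, hlt⟩ := h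
  obtain ⟨a, b, a', b', ha, hb, ha', hb', hbb, hC, hB⟩ := exists_relBoundWith_mul_lt hCA hBD hlt
  obtain ⟨θ, ⟨hθ1, hθ2⟩, hθ⟩ := exists_angle hφ' hψ' hbb
  have hτφ := le_max_left φ ψ
  have hτψ := le_max_right φ ψ
  have hs1 : 0 < Real.sin (θ - φ) := Real.sin_pos_of_pos_of_lt_pi (by linarith) (by linarith)
  have hs2 : 0 < Real.sin (θ + ψ) := Real.sin_pos_of_pos_of_lt_pi (by linarith) (by linarith)
  -- As `r → ∞` the left side tends to `b b'`, which the choice of `θ` keeps below the product of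
  -- sines.
  obtain ⟨r, hr, hrs⟩ : ∃ r : ℝ, 0 < r ∧
      (a / r + b) * (a' / r + b') < Real.sin (θ - φ) * Real.sin (θ + ψ) := by
    have hlim : Filter.Tendsto (fun r : ℝ => (a / r + b) * (a' / r + b')) Filter.atTop
        (nhds ((0 + b) * (0 + b'))) :=
      ((Filter.tendsto_id.const_div_atTop a).add_const b).mul
        ((Filter.tendsto_id.const_div_atTop a').add_const b')
    rw [zero_add, zero_add] at hlim
    exact ((Filter.eventually_gt_atTop 0).and (hlim.eventually_lt_const hθ)).exists
  have hre : ∀ t : ℝ, (Complex.exp (t * Complex.I)).re = Real.cos t :=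
    Complex.exp_ofReal_mul_I_re
  have him : ∀ t : ℝ, (Complex.exp (t * Complex.I)).im = Real.sin t :=
    Complex.exp_ofReal_mul_I_im
  have hcosφ : 0 < Real.cos φ := Real.cos_pos_of_mem_Ioo ⟨by linarith, hφ'⟩
  have hcosψ : 0 < Real.cos ψ := Real.cos_pos_of_mem_Ioo ⟨by linarith, hψ'⟩
  have hsinφ : 0 ≤ Real.sin φ := Real.sin_nonneg_of_nonneg_of_le_pi hφ (by linarith)
  have hsinψ : 0 ≤ Real.sin ψ := Real.sin_nonneg_of_nonneg_of_le_pi hψ (by linarith)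
  have hew : (Complex.exp ((-φ : ℝ) * Complex.I) * Complex.exp (θ * Complex.I)).im =
      Real.sin (θ - φ) := by
    rw [exp_mul_im, hre, him, Real.cos_neg, Real.sin_neg, Real.sin_sub]; ring
  have hew' : (Complex.exp (ψ * Complex.I) * Complex.exp (θ * Complex.I)).im =
      Real.sin (θ + ψ) := by
    rw [exp_mul_im, hre, him, Real.sin_add]
  -- Rotation by `-φ` puts `Σ_φ` in the closed lower half-plane. The point `-1 + i` lies in `ρ(A)`
  -- by m-accretivity and is rotated into the upper half-plane.
  obtain ⟨RA, hRA, P, hPn, hP⟩ := exists_relBounded_comp_resolvent ha hb hr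
    (Complex.norm_exp_ofReal_mul_I (-φ)) (Complex.norm_exp_ofReal_mul_I θ)
    (fun z hz => by
      have := ((mem_sector_iff hφ hφ'.le).mp (hWA hz)).2
      have := mul_le_mul_of_nonneg_right (le_abs_self z.im) hcosφ.le
      rw [exp_mul_im, Real.cos_neg, Real.sin_neg]
      linarith)
    (z₀ := ⟨-1, 1⟩) (by rw [exp_mul_im, Real.cos_neg, Real.sin_neg]; dsimp only; linarith)
    (hρA _ (by norm_num)) (hew ▸ hs1) hC
  -- The resolvent of `D` at `1 + i` is minus that of `-D` at `-1 - i`.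
  have hρD' : (⟨1, 1⟩ : ℂ) ∈ resolventSet D := by
    obtain ⟨R, hR1, hR2⟩ := hρD (-⟨1, 1⟩) (by norm_num)
    refine ⟨-R, fun y => ?_, fun y => ?_⟩
    · obtain ⟨hy, hy'⟩ := hR1 (-y)
      have hmem : (-R) y ∈ D.domain := by
        rw [neg_apply, ← map_neg]; exact hy
      refine ⟨hmem, ?_⟩
      change -D ⟨R (-y), hy⟩ - (-⟨1, 1⟩ : ℂ) • R (-y) = -y at hy'
      change D ⟨(-R) y, hmem⟩ - (⟨1, 1⟩ : ℂ) • (-R) y = y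
      have hR : (-R) y = R (-y) := by rw [neg_apply, ← map_neg]
      simp only [hR]
      rw [neg_smul, sub_neg_eq_add, neg_add_eq_sub] at hy'
      rw [← neg_sub, hy', neg_neg]
    · have hy := hR2 y
      change R (-D y - (-⟨1, 1⟩ : ℂ) • (y : H₂)) = y at hy
      change (-R) (D y - (⟨1, 1⟩ : ℂ) • (y : H₂)) = y
      rw [neg_smul, sub_neg_eq_add, neg_add_eq_sub] at hy
      rw [neg_apply, ← map_neg, neg_sub, hy]
  obtain ⟨RD, hRD, Q, hQn, hQ⟩ := exists_relBounded_comp_resolvent ha' hb' hr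
    (Complex.norm_exp_ofReal_mul_I ψ) (Complex.norm_exp_ofReal_mul_I θ)
    (fun z hz => by
      have := ((mem_sector_iff hψ hψ'.le).mp (hWD hz)).2
      rw [Complex.neg_re, Complex.neg_im, abs_neg] at this
      have := mul_le_mul_of_nonneg_right (le_abs_self z.im) hcosψ.le
      rw [exp_mul_im]
      linarith)
    (z₀ := ⟨1, 1⟩) (by rw [exp_mul_im]; dsimp only; linarith)
    hρD' (hew' ▸ hs2) hB
  rw [hew] at hPn
  rw [hew'] at hQn
  set z : ℂ := r * Complex.exp (θ * Complex.I) with hz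
  have hz_compl : z ∉ enclosure α δ φ ψ := by
    have hτ0 : 0 ≤ max φ ψ := hφ.trans hτφ
    have hτ1 : max φ ψ ≤ Real.pi / 2 := (max_lt hφ' hψ').le
    rw [notMem_enclosure_iff hτ0 hτ1]
    left
    have hsθ : 0 < Real.sin θ := Real.sin_pos_of_pos_of_lt_pi (by linarith) (by linarith)
    rw [hz, Complex.re_ofReal_mul, Complex.im_ofReal_mul, hre, him, abs_mul, abs_mul,
      abs_of_pos hr, abs_of_pos hsθ, mul_assoc, mul_assoc]
    refine mul_lt_mul_of_pos_left ?_ hr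
    -- Positivity of `sin (θ - τ)` and `sin (θ + τ)` amounts to `|cos θ| sin τ < sin θ cos τ`: the
    -- ray avoids the double sector.
    have e1 : 0 < Real.sin (θ - max φ ψ) :=
      Real.sin_pos_of_pos_of_lt_pi (by linarith) (by linarith)
    have e2 : 0 < Real.sin (θ + max φ ψ) :=
      Real.sin_pos_of_pos_of_lt_pi (by linarith) (by linarith)
    rw [Real.sin_sub] at e1
    rw [Real.sin_add] at e2
    rcases abs_cases (Real.cos θ) with ⟨h, -⟩ | ⟨h, -⟩ <;> rw [h] <;> linarith
  obtain ⟨c, hc, hlow⟩ := hlow z hz_compl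
  obtain ⟨U, V, hUV⟩ := exists_solve_offDiag P Q (by
    refine (mul_le_mul hPn hQn (norm_nonneg _) (by positivity)).trans_lt ?_
    rw [div_mul_div_comm, div_lt_one (by positivity)]
    exact hrs)
  refine ⟨z, mem_resolventSet_blockOp hc hlow (RA ∘L U) (RD ∘L V) fun p => ?_, hz_compl⟩
  obtain ⟨hA1, hA2⟩ := hRA.1 (U p)
  obtain ⟨hD1, hD2⟩ := hRD.1 (V p)
  obtain ⟨hC1, hC2⟩ := hP (U p)
  obtain ⟨hB1, hB2⟩ := hQ (V p)
  change A ⟨RA (U p), hA1⟩ - z • RA (U p) = U p at hA2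
  change D ⟨RD (V p), hD1⟩ - z • RD (V p) = V p at hD2
  refine ⟨hA1, hB1, hC1, hD1, ?_, ?_⟩
  · simp only [ContinuousLinearMap.comp_apply, hB2]
    rw [add_sub_right_comm, hA2]
    exact (hUV p).1
  · simp only [ContinuousLinearMap.comp_apply, hC2]
    rw [add_sub_assoc, hD2]
    exact (hUV p).2

end Block

end OpMatrix

theorem proposition6p5
    {H₁ H₂ : Type*}
    [NormedAddCommGroup H₁] [InnerProductSpace ℂ H₁] [CompleteSpace H₁]
    [NormedAddCommGroup H₂] [InnerProductSpace ℂ H₂] [CompleteSpace H₂]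
    (A : H₁ →ₗ.[ℂ] H₁) (B : H₂ →ₗ.[ℂ] H₁) (C : H₁ →ₗ.[ℂ] H₂) (D : H₂ →ₗ.[ℂ] H₂)
    -- the entries are densely defined and closable, the operator matrix is densely defined
    (hA : Dense (A.domain : Set H₁)) (hB : Dense (B.domain : Set H₂))
    (hC : Dense (C.domain : Set H₁)) (hD : Dense (D.domain : Set H₂))
    (hAc : A.IsClosable) (hBc : B.IsClosable) (hCc : C.IsClosable) (hDc : D.IsClosable)
    (hM : Dense ((OpMatrix.blockOp A B C D).domain : Set (WithLp 2 (H₁ × H₂))))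
    -- `C ⊆ B*`
    (hCB : C ≤ B.adjoint)
    (α δ φ ψ : ℝ) (hδ : δ < 0) (hα : 0 < α)
    (hφ : φ ∈ Set.Icc 0 (Real.pi / 2)) (hψ : ψ ∈ Set.Icc 0 (Real.pi / 2))
    (hWDδ : ∀ z ∈ OpMatrix.numRange D, z.re ≤ δ)
    (hWAα : ∀ z ∈ OpMatrix.numRange A, α ≤ z.re)
    (hWA : OpMatrix.numRange A ⊆ OpMatrix.sector φ)
    (hWD : OpMatrix.numRange D ⊆ -OpMatrix.sector ψ) :
    (φ < Real.pi / 2 → ψ < Real.pi / 2 → OpMatrix.Mconst φ ψ ∈ Set.Ioc 0 1) ∧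
    (OpMatrix.DiagDominant A B C D φ ψ ∨ OpMatrix.OffDiagDominant A B C D →
      (OpMatrix.resolventSet (OpMatrix.blockOp A B C D) ∩
        (OpMatrix.enclosure α δ φ ψ)ᶜ).Nonempty ∧
      OpMatrix.spec (OpMatrix.blockOp A B C D) ⊆ OpMatrix.enclosure α δ φ ψ) := by
  have h0 : 0 ≤ max φ ψ := hφ.1.trans (le_max_left _ _)
  have h1 : max φ ψ ≤ Real.pi / 2 := max_le hφ.2 hψ.2
  refine ⟨OpMatrix.Mconst_mem_Ioc hφ.1 hψ.1, fun h => ?_⟩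
  have hlow : ∀ z ∉ OpMatrix.enclosure α δ φ ψ, _ := fun z hz =>
    OpMatrix.exists_blockOp_lowerBound hB hCB hφ hψ hWDδ hWAα hWA hWD hz
  have hne : ∃ z ∈ OpMatrix.resolventSet (OpMatrix.blockOp A B C D),
      z ∉ OpMatrix.enclosure α δ φ ψ := by
    rcases h with h | h
    · exact OpMatrix.exists_mem_resolventSet_of_diagDominant hφ.1 hψ.1 hWA hWD hlow h
    · have hmem : (0 : ℂ) ∉ OpMatrix.enclosure α δ φ ψ :=
        (OpMatrix.notMem_enclosure_iff h0 h1).mpr (Or.inr ⟨hδ, hα⟩)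
      obtain ⟨c, hc, hb⟩ := hlow 0 hmem
      exact ⟨0, OpMatrix.zero_mem_resolventSet_of_offDiagDominant hB hc hb h, hmem⟩
  obtain ⟨z, hz, hz_compl⟩ := hne
  exact ⟨⟨z, hz, hz_compl⟩, Set.compl_subset_comm.mp (OpMatrix.subset_resolventSet
    (OpMatrix.isPreconnected_compl_enclosure hδ hα h0 h1) ⟨z, hz_compl, hz⟩ hlow)⟩
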